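/- **Setting.** Consider $\dot x = F(x,u) = f(x)+g(x)u$ with state space $\mathcal X\subseteq\mathbb R^n$, $f,g$ continuous on $\mathcal X$, and inputs in the nonempty box $\mathcal U=\{u\in\mathbb R^m : u_{\min}\le u\le u_{\max}\}$. A set $C$ is *control invariant* if for every initial time $\tau_0$ and every $x_0\in C$ there are a measurable $u:[\tau_0,\infty)\to\mathcal U$ and a trajectory $x$ of $\dot x=F(x,u)$ with $x(\tau_0)=x_0$ and $x(t)\in C$ for all $t\ge \tau_0$. (Here and for the set dynamics below, solutions are Carathéodory solutions.) **Sets.** A set state $s=(x_1,\dots,x_N)\in\mathbb R^{nN}$ consists of $N$ control points. Let $D\subseteq\mathbb R^{nN}$ be an open set of admissible set states. Each $s\in D$ determines a compact set $\Omega(s)\subseteq\mathcal X$ whose boundary is a $C^1$ hypersurface, with $\Omega(s)$ locally on one side and inward unit normal $n$, that passes through all $x_i$; radii $r_i(s)\ge 0$ with $\partial\Omega(s)\subseteq\bigcup_{i=1}^N \bar B_{r_i(s)}(x_i)$; and Lipschitz constants $L_{nf}(s)$ and $L_{ng}(s)$ of $n^Tf$ and $n^Tg$ on $\partial\Omega(s)$.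 Put $$L(s)=L_{nf}(s)+L_{LP}\,L_{ng}(s),\qquad L_{LP}=\Big\|\big(\max(|u_{\min,j}|,|u_{\max,j}|)\big)_{j=1}^m\Big\|_2,$$ $$b^*(x)=\sup_{u\in\mathcal U} n(x)^TF(x,u),\qquad \tilde b^*(x_i)=b^*(x_i)-L(s)\,r_i(s).$$ Assume that, for every $i$ and every fixed $u\in\mathcal U$, the function $s\mapsto n(x_i)^TF(x_i,u)-L(s)r_i(s)$ is $C^1$ on $D$. Let $u^*$ be an optimal input in the definition of $b^*(x_i)$. As usual, $\partial\tilde b^*(x_i)/\partial s$ denotes the derivative of that function with $u=u^*$ held fixed; it is the derivative of $\tilde b^*(x_i)$ wherever the latter is differentiable. **QP.** Let $\alpha:\mathbb R\to\mathbb R$ be continuous and strictly increasing with $\alpha(0)=0$, let $\eta^{\mathrm{ref}}(s)\in\mathbb R^{nN}$ be a reference input and $Q$ a weight matrix. Let $\eta^s(s)$ be, whenever the following problem is feasible, a solution of $$\min_{\eta\in\mathbb R^{nN}}(\eta-\eta^{\mathrm{ref}})^TQ(\eta-\eta^{\mathrm{ref}})\quad\text{s.t.}\quad \frac{\partial\tilde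 b^*(x_i)}{\partial s}\,\eta\ \ge\ -\alpha\big(\tilde b^*(x_i)\big),\quad i=1,\dots,N.$$ **Claim.** Let $s$ solve $\dot s=\eta^s(s)$ on $[t_0,\infty)$ with $s(t)\in D$ for all $t\ge t_0$. Suppose that the initial set is certified to be control invariant by the tightened margins, i.e. $\tilde b^*(x_i)\ge 0$ for $i=1,\dots,N$ at $s(t_0)$, and that the QP is feasible at $s(t)$ for every $t\ge t_0$. Then $\Omega(s(t))$ is control invariant for every $t\ge t_0$. -/

import Mathlib

open MeasureTheory Set Filter Topology
open scoped NNReal RealInnerProductSpace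

namespace SetExpansion

/-- Euclidean space `ℝ^k`, with the 2-norm. -/
abbrev Vec (k : ℕ) := EuclideanSpace ℝ (Fin k)

/-- A set state `s = (x_1, …, x_N)`: the positions of `N` control points in `ℝ^n`. -/
abbrev SetState (n N : ℕ) := Fin N → Vec n

/-- `x` solves `ẋ = v` on `[t₀, ∞)` in the sense of Carathéodory: `v` is integrable on every
`[t₀, t]` and `x t = x t₀ + ∫ v`. -/
def SolvesFrom {V : Type*} [NormedAddCommGroup V] [NormedSpace ℝ V]
    (t₀ : ℝ) (x v : ℝ → V) : Prop :=
  ∀ t, t₀ ≤ t → IntervalIntegrable v volume t₀ t ∧ x t = x t₀ + ∫ τ in t₀..t, v τ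

/-- A control-affine system `ẋ = f(x) + g(x) u` on a state space `𝒳 ⊆ ℝ^n`, with `f, g` continuous
on `𝒳` and with inputs in the nonempty box `u_min ≤ u ≤ u_max` of `ℝ^m`. -/
structure ControlSystem (n m : ℕ) where
  X : Set (Vec n)
  f : Vec n → Vec n
  g : Vec n → (Vec m →L[ℝ] Vec n)
  uMin : Vec m
  uMax : Vec m
  continuousOn_f : ContinuousOn f X
  continuousOn_g : ContinuousOn g X
  uMin_le_uMax : ∀ j, uMin j ≤ uMax j

namespace ControlSystem

variable {n m : ℕ} (S : ControlSystem n m)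

/-- The right-hand side `F(x, u) = f(x) + g(x) u`. -/
def F (x : Vec n) (u : Vec m) : Vec n := S.f x + S.g x u

/-- The feasible input set `𝒰`. -/
def U : Set (Vec m) := {u | ∀ j, S.uMin j ≤ u j ∧ u j ≤ S.uMax j}

/-- Control invariance: from every initial condition in `C` (at any initial time) some measurable
input with values in `𝒰` has a trajectory that stays in `C` for all future times. -/
def IsControlInvariant (C : Set (Vec n)) : Prop :=
  ∀ t₀ : ℝ, ∀ x₀ ∈ C, ∃ (u : ℝ → Vec m) (x : ℝ → Vec n),
    Measurable u ∧ (∀ t, t₀ ≤ t → u t ∈ S.U) ∧ x t₀ = x₀ ∧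
    SolvesFrom t₀ x (fun t => S.F (x t) (u t)) ∧ ∀ t, t₀ ≤ t → x t ∈ C

/-- `b*`: the supremum over `u ∈ 𝒰` of `νᵀ (f(x) + g(x) u)`. -/
noncomputable def bStar (ν x : Vec n) : ℝ := sSup ((fun u => ⟪ν, S.F x u⟫) '' S.U)

/-- The optimal inputs `u*` of the linear program that defines `b*`. -/
def optimalInputs (ν x : Vec n) : Set (Vec m) :=
  {u | u ∈ S.U ∧ IsMaxOn (fun u' => ⟪ν, S.F x u'⟫) S.U u}

/-- The Lipschitz constant of the box-constrained linear program over `𝒰` under perturbations of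
its cost vector: the 2-norm of the vector with entries `max (|u_min,j|, |u_max,j|)`. -/
noncomputable def lipLP : ℝ :=
  ‖(WithLp.toLp 2 (fun j => max |S.uMin j| |S.uMax j|) : Vec m)‖

end ControlSystem

/-- Near `x` the set `Ω` is the superlevel set `{h ≥ 0}` of a `C¹` function `h` with `h x = 0` and
`∇h(x) = ν`, `‖ν‖ = 1`. So `∂Ω` is a `C¹` hypersurface near `x`, with `Ω` on one side, and `ν` is
its unit normal at `x` that points into `Ω`. -/
def IsInwardUnitNormal {n : ℕ} (Ω : Set (Vec n)) (x ν : Vec n) : Prop :=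
  ‖ν‖ = 1 ∧ ∃ h : Vec n → ℝ, ContDiffAt ℝ 1 h x ∧ h x = 0 ∧ HasGradientAt h ν x ∧
    ∀ᶠ y in 𝓝 x, y ∈ Ω ↔ 0 ≤ h y

/-- The data attached to set states: the admissible set states, the set `Ω` that a set state
describes, the inward normal along `∂Ω`, the ball radii `r_i`, and the Lipschitz constants of
`nᵀ f` and `nᵀ g` along `∂Ω`. All of them may depend on the set state. -/
structure SetModel (n N : ℕ) where
  admissible : Set (SetState n N)
  Ω : SetState n N → Set (Vec n)
  normal : SetState n N → Vec n → Vec n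
  radius : SetState n N → Fin N → ℝ
  lipNF : SetState n N → ℝ≥0
  lipNG : SetState n N → ℝ≥0

namespace SetModel

variable {n m N : ℕ} (M : SetModel n N) (S : ControlSystem n m)

/-- `L = L_nf + L_LP * L_ng`. -/
noncomputable def lip (s : SetState n N) : ℝ := M.lipNF s + S.lipLP * M.lipNG s

/-- The tightened margin `b*(x_i) - L(s) r_i(s)`, as a function of the set state. -/
noncomputable def bTilde (s : SetState n N) (i : Fin N) : ℝ :=
  S.bStar (M.normal s (s i)) (s i) - M.lip S s * M.radius s i

/-- The tightened margin with the input held fixed at `u` instead of optimized. -/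
noncomputable def marginAt (u : Vec m) (i : Fin N) (s : SetState n N) : ℝ :=
  ⟪M.normal s (s i), S.F (s i) u⟫ - M.lip S s * M.radius s i

/-- The standing assumptions on the data, for every admissible set state. -/
structure IsValid : Prop where
  isOpen_admissible : IsOpen M.admissible
  isCompact_Ω : ∀ s ∈ M.admissible, IsCompact (M.Ω s)
  Ω_subset : ∀ s ∈ M.admissible, M.Ω s ⊆ S.X
  normal_spec : ∀ s ∈ M.admissible, ∀ x ∈ frontier (M.Ω s),
    IsInwardUnitNormal (M.Ω s) x (M.normal s x)
  point_mem : ∀ s ∈ M.admissible, ∀ i, s i ∈ frontier (M.Ω s)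
  radius_nonneg : ∀ s ∈ M.admissible, ∀ i, 0 ≤ M.radius s i
  cover : ∀ s ∈ M.admissible,
    frontier (M.Ω s) ⊆ ⋃ i, Metric.closedBall (s i) (M.radius s i)
  lipschitz_nf : ∀ s ∈ M.admissible,
    LipschitzOnWith (M.lipNF s) (fun x => ⟪M.normal s x, S.f x⟫) (frontier (M.Ω s))
  lipschitz_ng : ∀ s ∈ M.admissible,
    LipschitzOnWith (M.lipNG s)
      (fun x => ContinuousLinearMap.adjoint (S.g x) (M.normal s x)) (frontier (M.Ω s))
  contDiffOn_margin : ∀ u ∈ S.U, ∀ i, ContDiffOn ℝ 1 (M.marginAt S u i) M.admissible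

/-- The gradient of the tightened margin `i` at `s`: the optimal input `u*` is held fixed, and all
other quantities (`x_i`, the normal, `L`, `r_i`) are differentiated. -/
noncomputable def gradBTilde (uStar : SetState n N → Fin N → Vec m) (s : SetState n N)
    (i : Fin N) : SetState n N →L[ℝ] ℝ :=
  fderiv ℝ (M.marginAt S (uStar s i) i) s

/-- The feasible set of the quadratic program at `s`:
`(∂b̃*(x_i)/∂s) η ≥ -α (b̃*(x_i))` for `i = 1, …, N`. -/
def qpFeasible (uStar : SetState n N → Fin N → Vec m) (α : ℝ → ℝ) (s : SetState n N) :
    Set (SetState n N) :=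
  {η | ∀ i, -α (M.bTilde S s i) ≤ M.gradBTilde S uStar s i η}

/-- The cost `(η - η_ref)ᵀ Q (η - η_ref)`. -/
def qpCost (Q : Matrix (Fin N × Fin n) (Fin N × Fin n) ℝ) (ηref η : SetState n N) : ℝ :=
  dotProduct (fun p : Fin N × Fin n => (η - ηref) p.1 p.2)
    (Q.mulVec (fun p : Fin N × Fin n => (η - ηref) p.1 p.2))

/-- The minimizers of the quadratic program at `s`. -/
def qpSolutions (uStar : SetState n N → Fin N → Vec m) (α : ℝ → ℝ)
    (Q : Matrix (Fin N × Fin n) (Fin N × Fin n) ℝ) (ηref : SetState n N → SetState n N)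
    (s : SetState n N) : Set (SetState n N) :=
  {η | η ∈ M.qpFeasible S uStar α s ∧
    IsMinOn (qpCost Q (ηref s)) (M.qpFeasible S uStar α s) η}

/-- Wherever the tightened margin is differentiable in the set state, its derivative is
`gradBTilde`, whichever optimal input is used. -/
theorem fderiv_bTilde_eq (uStar : SetState n N → Fin N → Vec m) (s : SetState n N) (i : Fin N)
    (hu : uStar s i ∈ S.optimalInputs (M.normal s (s i)) (s i))
    (hb : DifferentiableAt ℝ (fun s' => M.bTilde S s' i) s)
    (hm : DifferentiableAt ℝ (M.marginAt S (uStar s i) i) s) :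
    fderiv ℝ (fun s' => M.bTilde S s' i) s = M.gradBTilde S uStar s i := by
  have hc : IsCompact S.U := by
    have h1 : S.U = (EuclideanSpace.equiv (Fin m) ℝ).toHomeomorph ⁻¹'
        (Set.Icc (fun j => S.uMin j) (fun j => S.uMax j)) := by
      ext u
      simp [ControlSystem.U, Set.mem_Icc, Pi.le_def, forall_and]
    rw [h1]
    exact (Homeomorph.isCompact_preimage _).2 isCompact_Icc
  have hbdd : ∀ ν x : Vec n, BddAbove ((fun u => ⟪ν, S.F x u⟫) '' S.U) := by
    intro ν x
    refine (hc.image ?_).bddAbove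
    unfold ControlSystem.F
    fun_prop
  have hle : ∀ s', M.marginAt S (uStar s i) i s' ≤ M.bTilde S s' i := by
    intro s'
    exact sub_le_sub_right (le_csSup (hbdd _ _) (Set.mem_image_of_mem _ hu.1)) _
  have heq : M.marginAt S (uStar s i) i s = M.bTilde S s i := by
    refine le_antisymm (hle s) (sub_le_sub_right (csSup_le ⟨_, Set.mem_image_of_mem _ hu.1⟩ ?_) _)
    rintro _ ⟨v, hv, rfl⟩
    exact hu.2 hv
  have hmin : IsLocalMin ((fun s' => M.bTilde S s' i) - M.marginAt S (uStar s i) i) s := by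
    refine Filter.Eventually.of_forall fun s' => ?_
    simp only [Pi.sub_apply]
    linarith [hle s']
  have h0 := hmin.fderiv_eq_zero
  rw [fderiv_sub hb hm] at h0
  exact sub_eq_zero.1 h0

end SetModel

end SetExpansion

/-! Two facts are combined: nonnegative tightened margins make `Ω(s)` control invariant, and the QP
constraints keep these margins nonnegative.

For the first, a boundary point lies within `r_i` of some control point. Holding the optimal input
of that control point fixed, the inward velocity drops by at most `L r_i` on the way there, so it
stays nonnegative (`IsValid.inner_sub_le`). This is Nagumo's condition, and invariance follows by an
Euler construction (`exists_viable_trajectory`): tilting the velocity slightly inward gives steps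
that remain in `Ω`, with a step length uniform by compactness. In the limit of vanishing steps the
inputs themselves need not converge, but their primitives do. Since the dynamics are affine in the
input and `𝒰` is convex and compact, the derivative of the limit primitive is an admissible input
almost everywhere.

For the second, the margins are assumed `C¹` only for each fixed input. They are affine in the
input, so over the box they share a Lipschitz constant on compact sets, and so does their maximum
`b̃*`. Hence `b̃*` is absolutely continuous along `s`. Where it is differentiable, it touches the
fixed-input margin from above, so the two derivatives agree and the constraint applies. A negative
margin then has nonnegative derivative almost everywhere, so the margin cannot become negative. -/

namespace SetExpansion

/-! ### Euler schemes that stay in a compact set -/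

section Viability

variable {E V : Type*} [NormedAddCommGroup E] [NormedSpace ℝ E]
  [NormedAddCommGroup V] [NormedSpace ℝ V]

/-- An `ε`-approximate Euler scheme with step `δ` for `ẋ = f(x) + g(x) u` that starts at `x₀`,
remains in `Ω` and uses inputs in `U`. -/
structure IsEulerScheme (Ω : Set E) (U : Set V) (f : E → E) (g : E → V →L[ℝ] E) (x₀ : E)
    (δ ε : ℝ) (X : ℕ → E) (u : ℕ → V) : Prop where
  zero : X 0 = x₀
  mem : ∀ j, X j ∈ Ω
  input_mem : ∀ j, u j ∈ U
  step : ∀ j, ‖X (j + 1) - X j - δ • (f (X j) + g (X j) (u j))‖ ≤ δ * ε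

variable {Ω : Set E} {U : Set V} {f : E → E} {g : E → V →L[ℝ] E} {x₀ : E} {δ ε : ℝ}
  {X : ℕ → E} {u : ℕ → V}

theorem exists_isEulerScheme (hδ : 0 ≤ δ) (hx₀ : x₀ ∈ Ω)
    (h : ∀ y ∈ Ω, ∃ u ∈ U, ∃ w, ‖w - (f y + g y u)‖ ≤ ε ∧ y + δ • w ∈ Ω) :
    ∃ X u, IsEulerScheme Ω U f g x₀ δ ε X u := by
  choose! c hcU w hw hmem using h
  let X : ℕ → E := fun j => (fun y => y + δ • w y)^[j] x₀
  have hX : ∀ j, X (j + 1) = X j + δ • w (X j) := fun j => Function.iterate_succ_apply' _ _ _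
  have hΩ : ∀ j, X j ∈ Ω := by
    intro j
    induction j with
    | zero => exact hx₀
    | succ j ih => rw [hX]; exact hmem _ ih
  refine ⟨X, fun j => c (X j), rfl, hΩ, fun j => hcU _ (hΩ j), fun j => ?_⟩
  rw [hX, add_sub_cancel_left, ← smul_sub, norm_smul, Real.norm_of_nonneg hδ]
  exact mul_le_mul_of_nonneg_left (hw _ (hΩ j)) hδ

theorem IsEulerScheme.norm_sub_le (h : IsEulerScheme Ω U f g x₀ δ ε X u) (hδ : 0 ≤ δ) {K : ℝ}
    (hK : ∀ y ∈ Ω, ∀ c ∈ U, ‖f y + g y c‖ ≤ K) {i j : ℕ} (hij : i ≤ j) :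
    ‖X j - X i‖ ≤ (K + ε) * (δ * (j - i)) := by
  induction j, hij using Nat.le_induction with
  | base => simp
  | succ j hij ih =>
    have h1 := h.step j
    have h2 : ‖δ • (f (X j) + g (X j) (u j))‖ ≤ δ * K := by
      rw [norm_smul, Real.norm_of_nonneg hδ]
      exact mul_le_mul_of_nonneg_left (hK _ (h.mem j) _ (h.input_mem j)) hδ
    have h3 : X (j + 1) - X i = (X (j + 1) - X j - δ • (f (X j) + g (X j) (u j)))
        + δ • (f (X j) + g (X j) (u j)) + (X j - X i) := by abel
    rw [h3]
    refine (norm_add₃_le ..).trans ?_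
    push_cast
    linarith

/-- With `f` and `g` frozen at `X i`, linearity lets the inputs enter only through their sum. This
form survives a limit in which only the primitives of the inputs converge. -/
theorem IsEulerScheme.norm_defect_le (h : IsEulerScheme Ω U f g x₀ δ ε X u) (hδ : 0 ≤ δ) {η : ℝ}
    {i j : ℕ} (hij : i ≤ j)
    (hη : ∀ l, i ≤ l → l < j → ∀ c ∈ U, ‖(f (X l) + g (X l) c) - (f (X i) + g (X i) c)‖ ≤ η) :
    ‖X j - X i - (δ * (j - i)) • f (X i)
      - g (X i) (δ • (∑ l ∈ Finset.range j, u l) - δ • ∑ l ∈ Finset.range i, u l)‖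
      ≤ (ε + η) * (δ * (j - i)) := by
  induction j, hij using Nat.le_induction with
  | base => simp
  | succ j hij ih =>
    have h0 := ih fun l hl hl' => hη l hl (by omega)
    have h1 := h.step j
    have h2 : ‖δ • ((f (X j) + g (X j) (u j)) - (f (X i) + g (X i) (u j)))‖ ≤ δ * η := by
      rw [norm_smul, Real.norm_of_nonneg hδ]
      exact mul_le_mul_of_nonneg_left (hη j hij (by omega) _ (h.input_mem j)) hδ
    have h3 : X (j + 1) - X i - (δ * ((j + 1 : ℕ) - i)) • f (X i)
        - g (X i) (δ • (∑ l ∈ Finset.range (j + 1), u l) - δ • ∑ l ∈ Finset.range i, u l)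
        = (X (j + 1) - X j - δ • (f (X j) + g (X j) (u j)))
          + δ • ((f (X j) + g (X j) (u j)) - (f (X i) + g (X i) (u j)))
          + (X j - X i - (δ * (j - i)) • f (X i)
            - g (X i) (δ • (∑ l ∈ Finset.range j, u l) - δ • ∑ l ∈ Finset.range i, u l)) := by
      rw [Finset.sum_range_succ]
      push_cast
      simp only [map_sub, map_smul, map_add]
      module
    rw [h3]
    refine (norm_add₃_le ..).trans ?_
    push_cast
    linarith

theorem IsEulerScheme.average_mem (h : IsEulerScheme Ω U f g x₀ δ ε X u) (hU : Convex ℝ U)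
    (hδ : 0 < δ) {i j : ℕ} (hij : i < j) :
    (δ * (j - i) : ℝ)⁻¹ • (δ • (∑ l ∈ Finset.range j, u l) - δ • ∑ l ∈ Finset.range i, u l) ∈ U := by
  have hpos : (0 : ℝ) < j - i := sub_pos.2 (by exact_mod_cast hij)
  have h1 : (δ * (j - i) : ℝ)⁻¹ • (δ • (∑ l ∈ Finset.range j, u l) - δ • ∑ l ∈ Finset.range i, u l)
      = ∑ l ∈ Finset.Ico i j, ((j - i : ℝ)⁻¹) • u l := by
    rw [← smul_sub, smul_smul, ← Finset.sum_Ico_eq_sub _ hij.le, ← Finset.smul_sum]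
    congr 1
    field_simp
  rw [h1]
  refine hU.sum_mem (fun _ _ => (inv_pos.2 hpos).le) ?_ fun l _ => h.input_mem l
  rw [Finset.sum_const, Nat.card_Ico, nsmul_eq_mul, Nat.cast_sub hij.le]
  exact mul_inv_cancel₀ hpos.ne'

theorem exists_forall_norm_velocity_sub_le (hΩ : IsCompact Ω) (hU : IsCompact U)
    (hf : ContinuousOn f Ω) (hg : ContinuousOn g Ω) {η : ℝ} (hη : 0 < η) :
    ∃ ρ > 0, ∀ y ∈ Ω, ∀ z ∈ Ω, ‖y - z‖ < ρ → ∀ c ∈ U,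
      ‖(f y + g y c) - (f z + g z c)‖ ≤ η := by
  have hc : ContinuousOn (fun p : E × V => f p.1 + g p.1 p.2) (Ω ×ˢ U) :=
    (hf.comp continuousOn_fst fun p hp => hp.1).add
      ((hg.comp continuousOn_fst fun p hp => hp.1).clm_apply continuousOn_snd)
  obtain ⟨ρ, hρ, h⟩ := Metric.uniformContinuousOn_iff.1
    ((hΩ.prod hU).uniformContinuousOn_of_continuous hc) η hη
  refine ⟨ρ, hρ, fun y hy z hz hyz c hcU => ?_⟩
  have := h (y, c) ⟨hy, hcU⟩ (z, c) ⟨hz, hcU⟩ (by simpa [Prod.dist_eq, dist_eq_norm, hρ] using hyz)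
  simpa [dist_eq_norm] using this.le

theorem exists_forall_norm_velocity_le (hΩ : IsCompact Ω) (hU : IsCompact U)
    (hf : ContinuousOn f Ω) (hg : ContinuousOn g Ω) :
    ∃ K ≥ 0, ∀ y ∈ Ω, ∀ c ∈ U, ‖f y + g y c‖ ≤ K := by
  have hc : ContinuousOn (fun p : E × V => f p.1 + g p.1 p.2) (Ω ×ˢ U) :=
    (hf.comp continuousOn_fst fun p hp => hp.1).add
      ((hg.comp continuousOn_fst fun p hp => hp.1).clm_apply continuousOn_snd)
  obtain ⟨K, hK⟩ := (hΩ.prod hU).exists_bound_of_continuousOn hc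
  exact ⟨max K 0, le_max_right _ _, fun y hy c hcU => (hK (y, c) ⟨hy, hcU⟩).trans (le_max_left _ _)⟩

/-- Elapsed grid time converges to true elapsed time. The natural-number floor is `0` for negative
`r`, hence the `max`: the interpolated curves are constant before the initial time. -/
theorem tendsto_mul_floor_div {ι : Type*} {l : Filter ι} {d : ι → ℝ} (hd : Tendsto d l (𝓝 0))
    (hpos : ∀ k, 0 < d k) (r : ℝ) :
    Tendsto (fun k => d k * (⌊r / d k⌋₊ : ℝ)) l (𝓝 (max r 0)) := by
  have hlow : Tendsto (fun k => max r 0 - d k) l (𝓝 (max r 0)) := by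
    simpa using tendsto_const_nhds.sub hd
  refine tendsto_of_tendsto_of_tendsto_of_le_of_le hlow tendsto_const_nhds (fun k => ?_) fun k => ?_
  · have h1 := Nat.lt_floor_add_one (r / d k)
    have h2 : r < d k * (⌊r / d k⌋₊ + 1) := by
      rwa [div_lt_iff₀ (hpos k), mul_comm] at h1
    have h3 : 0 ≤ d k * (⌊r / d k⌋₊ : ℝ) := mul_nonneg (hpos k).le (Nat.cast_nonneg _)
    rcases le_total r 0 with hr | hr
    · simp only [max_eq_right hr]; linarith [hpos k]
    · simp only [max_eq_left hr]; linarith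
  · rcases le_total r 0 with hr | hr
    · simp [Nat.floor_of_nonpos (div_nonpos_of_nonpos_of_nonneg hr (hpos k).le)]
    · have h1 := Nat.floor_le (div_nonneg hr (hpos k).le)
      rw [le_div_iff₀ (hpos k), mul_comm] at h1
      exact h1.trans (le_max_left _ _)

end Viability

/-! ### The limit of Euler schemes -/

section Viability

variable {E V : Type*} [NormedAddCommGroup E] [NormedSpace ℝ E]
  [NormedAddCommGroup V] [NormedSpace ℝ V]
  {Ω : Set E} {U : Set V} {f : E → E} {g : E → V →L[ℝ] E} {x₀ : E} {δ ε : ℝ}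
  {X : ℕ → E} {u : ℕ → V}

theorem lipschitzWith_of_forall_le {F : Type*} [NormedAddCommGroup F] {x : ℝ → F} {K : ℝ≥0}
    (h : ∀ s t, s ≤ t → ‖x t - x s‖ ≤ K * (t - s)) : LipschitzWith K x := by
  refine LipschitzWith.of_dist_le_mul fun s t => ?_
  rcases le_total s t with hst | hst
  · rw [dist_comm, dist_comm s t, dist_eq_norm, Real.dist_eq, abs_of_nonneg (sub_nonneg.2 hst)]
    exact h s t hst
  · rw [dist_eq_norm, Real.dist_eq, abs_of_nonneg (sub_nonneg.2 hst)]
    exact h t s hst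

theorem IsEulerScheme.norm_input_sum_sub_le (h : IsEulerScheme Ω U f g x₀ δ ε X u) (hδ : 0 ≤ δ)
    {R : ℝ} (hR : ∀ c ∈ U, ‖c‖ ≤ R) {i j : ℕ} (hij : i ≤ j) :
    ‖δ • (∑ l ∈ Finset.range j, u l) - δ • ∑ l ∈ Finset.range i, u l‖ ≤ R * (δ * (j - i)) := by
  rw [← smul_sub, ← Finset.sum_Ico_eq_sub _ hij, norm_smul, Real.norm_of_nonneg hδ]
  have h1 : ‖∑ l ∈ Finset.Ico i j, u l‖ ≤ ∑ _l ∈ Finset.Ico i j, R :=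
    norm_sum_le_of_le _ fun l _ => hR _ (h.input_mem l)
  rw [Finset.sum_const, Nat.card_Ico, nsmul_eq_mul, Nat.cast_sub hij] at h1
  calc _ ≤ δ * ((j - i) * R) := mul_le_mul_of_nonneg_left h1 hδ
    _ = _ := by ring

/-- Euler schemes with vanishing step and error accumulate at a Lipschitz curve `x` in `Ω` together
with a primitive `v` of the input. -/
theorem exists_limit_of_eulerSchemes [ProperSpace V] (hΩ : IsCompact Ω) (hU : IsCompact U)
    (hUc : Convex ℝ U) (hf : ContinuousOn f Ω) (hg : ContinuousOn g Ω)
    {d e : ℕ → ℝ} (hd : Tendsto d atTop (𝓝 0)) (hdpos : ∀ k, 0 < d k)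
    (he : Tendsto e atTop (𝓝 0)) {X : ℕ → ℕ → E} {u : ℕ → ℕ → V}
    (h : ∀ k, IsEulerScheme Ω U f g x₀ (d k) (e k) (X k) (u k)) (t₀ : ℝ) :
    ∃ (K R : ℝ≥0) (x : ℝ → E) (v : ℝ → V), LipschitzWith K x ∧ LipschitzWith R v ∧ x t₀ = x₀ ∧
      (∀ t, x t ∈ Ω) ∧ (∀ s t, t₀ ≤ s → s < t → (t - s)⁻¹ • (v t - v s) ∈ U) ∧
      ∀ η > 0, ∃ ρ > 0, ∀ s t, t₀ ≤ s → s ≤ t → t - s < ρ →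
        ‖x t - x s - (t - s) • f (x s) - g (x s) (v t - v s)‖ ≤ η * (t - s) := by
  obtain ⟨K, hK0, hK⟩ := exists_forall_norm_velocity_le hΩ hU hf hg
  obtain ⟨R, hR0, hR⟩ : ∃ R ≥ 0, ∀ c ∈ U, ‖c‖ ≤ R := by
    obtain ⟨R, hR⟩ := hU.isBounded.exists_norm_le
    exact ⟨max R 0, le_max_right _ _, fun c hc => (hR c hc).trans (le_max_left _ _)⟩
  -- One ultrafilter gives convergence at all times simultaneously, in place of an Arzelà–Ascoli
  -- argument with subsequences.
  let 𝒰 : Ultrafilter ℕ := hyperfilter ℕ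
  have h𝒰 : (𝒰 : Filter ℕ) ≤ atTop := Nat.hyperfilter_le_atTop
  have hd' := hd.mono_left h𝒰
  have he' := he.mono_left h𝒰
  let J : ℕ → ℝ → ℕ := fun k t => ⌊(t - t₀) / d k⌋₊
  have hJ : ∀ k {s t}, s ≤ t → J k s ≤ J k t := fun k s t hst =>
    Nat.floor_le_floor (div_le_div_of_nonneg_right (by linarith) (hdpos k).le)
  have hJ0 : ∀ k, J k t₀ = 0 := fun k => by simp [J]
  let W : ℕ → ℝ → V := fun k t => d k • ∑ l ∈ Finset.range (J k t), u k l
  have hm : ∀ t, Tendsto (fun k => d k * (J k t : ℝ)) 𝒰 (𝓝 (max (t - t₀) 0)) := fun t =>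
    tendsto_mul_floor_div hd' hdpos _
  have hmm : ∀ s t, Tendsto (fun k => d k * ((J k t : ℝ) - J k s)) 𝒰
      (𝓝 (max (t - t₀) 0 - max (s - t₀) 0)) := fun s t => by
    simpa only [mul_sub] using (hm t).sub (hm s)
  have hmax : ∀ s t : ℝ, s ≤ t → max (t - t₀) 0 - max (s - t₀) 0 ≤ t - s := by
    intro s t hst
    rcases le_total (t - t₀) 0 with h1 | h1 <;> rcases le_total (s - t₀) 0 with h2 | h2 <;>
      simp only [h1, h2, max_eq_left, max_eq_right] <;> linarith
  have hmm' : ∀ s t, t₀ ≤ s → s ≤ t →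
      Tendsto (fun k => d k * ((J k t : ℝ) - J k s)) 𝒰 (𝓝 (t - s)) := fun s t hs hst => by
    have := hmm s t
    rwa [max_eq_left (by linarith), max_eq_left (by linarith), sub_sub_sub_cancel_right] at this
  have hx : ∀ t, ∃ y ∈ Ω, Tendsto (fun k => X k (J k t)) 𝒰 (𝓝 y) := fun t =>
    hΩ.ultrafilter_le_nhds (𝒰.map fun k => X k (J k t))
      (tendsto_principal.2 (Eventually.of_forall fun k => (h k).mem _))
  have hv : ∀ t, ∃ y, Tendsto (fun k => W k t) 𝒰 (𝓝 y) := fun t => by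
    have hb : ∀ᶠ k in (𝒰 : Filter ℕ), W k t ∈ Metric.closedBall (0 : V)
        (R * (max (t - t₀) 0 + 1)) := by
      filter_upwards [(hm t).eventually (gt_mem_nhds (lt_add_one _))] with k hk
      have := (h k).norm_input_sum_sub_le (hdpos k).le hR (Nat.zero_le (J k t))
      simp only [Finset.range_zero, Finset.sum_empty, smul_zero, sub_zero, Nat.cast_zero] at this
      rw [mem_closedBall_zero_iff]
      exact this.trans (mul_le_mul_of_nonneg_left hk.le hR0)
    obtain ⟨y, -, hy⟩ := (isCompact_closedBall (0 : V) _).ultrafilter_le_nhds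
      (𝒰.map fun k => W k t) (tendsto_principal.2 hb)
    exact ⟨y, hy⟩
  choose x hxΩ hx using hx
  choose v hv using hv
  refine ⟨⟨K, hK0⟩, ⟨R, hR0⟩, x, v, lipschitzWith_of_forall_le fun s t hst => ?_,
    lipschitzWith_of_forall_le fun s t hst => ?_, ?_, hxΩ, fun s t hs hst => ?_, fun η hη => ?_⟩
  · have h1 : Tendsto (fun k => (K + e k) * (d k * ((J k t : ℝ) - J k s))) 𝒰
        (𝓝 ((K + 0) * (max (t - t₀) 0 - max (s - t₀) 0))) :=
      (tendsto_const_nhds.add he').mul (hmm s t)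
    have h2 := le_of_tendsto_of_tendsto' ((hx t).sub (hx s)).norm h1 fun k =>
      (h k).norm_sub_le (hdpos k).le hK (hJ k hst)
    rw [add_zero] at h2
    exact h2.trans (mul_le_mul_of_nonneg_left (hmax s t hst) hK0)
  · have h2 := le_of_tendsto_of_tendsto' ((hv t).sub (hv s)).norm ((hmm s t).const_mul R) fun k =>
      (h k).norm_input_sum_sub_le (hdpos k).le hR (hJ k hst)
    exact h2.trans (mul_le_mul_of_nonneg_left (hmax s t hst) hR0)
  · refine tendsto_nhds_unique (hx t₀) ?_
    simp only [hJ0, (h _).zero]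
    exact tendsto_const_nhds
  · have h1 := ((hmm' s t hs hst.le).inv₀ (sub_pos.2 hst).ne').smul ((hv t).sub (hv s))
    refine hU.isClosed.mem_of_tendsto h1 ?_
    filter_upwards [(hmm' s t hs hst.le).eventually (lt_mem_nhds (sub_pos.2 hst))] with k hk
    refine (h k).average_mem hUc (hdpos k) ?_
    have := pos_of_mul_pos_right hk (hdpos k).le
    exact_mod_cast sub_pos.1 this
  · obtain ⟨ρ, hρ, hunif⟩ := exists_forall_norm_velocity_sub_le hΩ hU hf hg hη
    -- A duration below `ρ / (K + 1)` keeps the displacement bound `K * (t - s)` below `ρ`, hence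
    -- eventually also that of the schemes; the `+ 1` covers `K = 0`.
    refine ⟨ρ / (K + 1), by positivity, fun s t hs hst hlt => ?_⟩
    have hm1 := hmm' s t hs hst
    have hgx : Tendsto (fun k => g (X k (J k s))) 𝒰 (𝓝 (g (x s))) :=
      (hg (x s) (hxΩ s)).tendsto.comp (tendsto_nhdsWithin_iff.2
        ⟨hx s, Eventually.of_forall fun k => (h k).mem _⟩)
    have hfx : Tendsto (fun k => f (X k (J k s))) 𝒰 (𝓝 (f (x s))) :=
      (hf (x s) (hxΩ s)).tendsto.comp (tendsto_nhdsWithin_iff.2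
        ⟨hx s, Eventually.of_forall fun k => (h k).mem _⟩)
    have hleft := ((((hx t).sub (hx s)).sub (hm1.smul hfx)).sub
      ((isBoundedBilinearMap_apply (𝕜 := ℝ).continuous.tendsto _).comp
        (hgx.prodMk_nhds ((hv t).sub (hv s))))).norm
    have hright : Tendsto (fun k => (e k + η) * (d k * ((J k t : ℝ) - J k s))) 𝒰
        (𝓝 ((0 + η) * (t - s))) := (he'.add tendsto_const_nhds).mul hm1
    rw [zero_add] at hright
    refine le_of_tendsto_of_tendsto hleft hright ?_
    have hsmall : (K + 0) * (t - s) < ρ := by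
      rw [lt_div_iff₀ (by positivity)] at hlt
      nlinarith [sub_nonneg.2 hst]
    have h4 := ((tendsto_const_nhds.add he').mul hm1).eventually (gt_mem_nhds hsmall)
    filter_upwards [h4] with k hk
    refine (h k).norm_defect_le (hdpos k).le (hJ k hst) fun l hl hl' c hc => ?_
    refine hunif _ ((h k).mem l) _ ((h k).mem _) (lt_of_le_of_lt ?_ hk) c hc
    refine ((h k).norm_sub_le (hdpos k).le hK hl).trans ?_
    -- The error `e k` is nonnegative because `d k * e k` bounds a norm.
    have hnn : 0 ≤ K + e k := by
      have h6 := (h k).step 0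
      have h7 := nonneg_of_mul_nonneg_right ((norm_nonneg _).trans h6) (hdpos k)
      linarith
    have h8 : (l : ℝ) ≤ J k t := by exact_mod_cast hl'.le
    have := (hdpos k).le
    gcongr

end Viability

/-! ### From the limit curve to a Carathéodory solution -/

section Viability

/-- A Lipschitz curve is the integral of its almost everywhere derivative. -/
theorem solvesFrom_of_lipschitzWith {E : Type*} [NormedAddCommGroup E] [NormedSpace ℝ E]
    [FiniteDimensional ℝ E] {K : ℝ≥0} {x w : ℝ → E} {t₀ : ℝ} (hx : LipschitzWith K x)
    (hw : ∀ᵐ t, t₀ ≤ t → HasDerivAt x (w t) t) : SolvesFrom t₀ x w := by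
  borelize E
  have : CompleteSpace E := FiniteDimensional.complete ℝ E
  have hae : ∀ᵐ t, DifferentiableAt ℝ x t := hx.ae_differentiableAt_real
  have hbound : ∀ t, ‖deriv x t‖ ≤ K := fun t => norm_deriv_le_of_lipschitz hx
  have hint : ∀ a b, IntervalIntegrable (deriv x) volume a b := fun a b =>
    (intervalIntegrable_const (c := (K : ℝ))).mono_fun
      (aestronglyMeasurable_deriv x _)
      (Eventually.of_forall fun t => by simpa using hbound t)
  have heq : ∀ᵐ t, t₀ ≤ t → deriv x t = w t := by
    filter_upwards [hw] with t ht h using (ht h).deriv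
  intro t ht
  have heq' : ∀ᵐ τ, τ ∈ uIoc t₀ t → deriv x τ = w τ := by
    filter_upwards [heq] with τ hτ hmem
    rw [uIoc_of_le ht] at hmem
    exact hτ hmem.1.le
  refine ⟨(hint t₀ t).congr_ae ((ae_restrict_iff' measurableSet_uIoc).2 heq'), ?_⟩
  rw [← intervalIntegral.integral_congr_ae heq']
  let I : ℝ → E := fun τ => ∫ r in t₀..τ, deriv x r
  have hI : LipschitzWith K I := LipschitzWith.of_dist_le_mul fun a b => by
    rw [dist_eq_norm, Real.dist_eq, intervalIntegral.integral_interval_sub_left (hint _ _) (hint _ _)]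
    exact intervalIntegral.norm_integral_le_of_norm_le_const fun r _ => hbound r
  -- The difference is absolutely continuous with derivative zero almost everywhere, hence constant.
  have hac : AbsolutelyContinuousOnInterval (x - I) t₀ t :=
    (hx.lipschitzOnWith.absolutelyContinuousOnInterval).sub
      hI.lipschitzOnWith.absolutelyContinuousOnInterval
  obtain ⟨C, hC⟩ := hac.const_of_ae_hasDerivAt_zero (by
    filter_upwards [hae, (hint t₀ t).ae_hasDerivAt_integral] with τ h1 h2 h3
    simpa using h1.hasDerivAt.sub (h2 h3 t₀ left_mem_uIcc))
  have h1 := hC t₀ left_mem_uIcc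
  have h2 := hC t right_mem_uIcc
  simp only [Pi.sub_apply, I, intervalIntegral.integral_same, sub_zero] at h1 h2
  rw [h1, ← h2, sub_add_cancel]

variable {E V : Type*} [NormedAddCommGroup E] [NormedSpace ℝ E] [FiniteDimensional ℝ E]
  [NormedAddCommGroup V] [NormedSpace ℝ V] [FiniteDimensional ℝ V]
  [MeasurableSpace V] [BorelSpace V]
  {Ω : Set E} {U : Set V} {f : E → E} {g : E → V →L[ℝ] E} {x₀ : E}

/-- For each tolerance the step length must work at every point of `Ω`, so that a scheme can be
continued indefinitely. The input is recovered as the derivative of the limit primitive `v`, which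
exists almost everywhere because `v` is Lipschitz. -/
theorem exists_viable_trajectory (hΩ : IsCompact Ω) (hU : IsCompact U)
    (hUc : Convex ℝ U) (hf : ContinuousOn f Ω) (hg : ContinuousOn g Ω) (hx₀ : x₀ ∈ Ω)
    (hstep : ∀ ε > (0 : ℝ), ∃ δ₀ > (0 : ℝ), ∀ δ : ℝ, 0 < δ → δ ≤ δ₀ → ∀ y ∈ Ω,
      ∃ u ∈ U, ∃ w, ‖w - (f y + g y u)‖ ≤ ε ∧ y + δ • w ∈ Ω) (t₀ : ℝ) :
    ∃ (u : ℝ → V) (x : ℝ → E), Measurable u ∧ (∀ t, u t ∈ U) ∧ x t₀ = x₀ ∧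
      SolvesFrom t₀ x (fun t => f (x t) + g (x t) (u t)) ∧ ∀ t, x t ∈ Ω := by
  classical
  have : ProperSpace V := FiniteDimensional.proper ℝ V
  have : CompleteSpace V := FiniteDimensional.complete ℝ V
  have hex : ∀ k : ℕ, ∃ d : ℝ, 0 < d ∧ d ≤ 1 / ((k : ℝ) + 1) ∧
      ∃ X u, IsEulerScheme Ω U f g x₀ d (1 / ((k : ℝ) + 1)) X u := by
    intro k
    have hk : (0 : ℝ) < 1 / ((k : ℝ) + 1) := by positivity
    obtain ⟨δ₀, hδ₀, h⟩ := hstep _ hk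
    have hmin := lt_min hδ₀ hk
    exact ⟨min δ₀ (1 / ((k : ℝ) + 1)), hmin, min_le_right _ _,
      exists_isEulerScheme hmin.le hx₀ (h _ hmin (min_le_left _ _))⟩
  choose d hdpos hd X u hXu using hex
  have hlim := tendsto_one_div_add_atTop_nhds_zero_nat (𝕜 := ℝ)
  obtain ⟨K, R, x, v, hx, hv, hx0, hxΩ, hvU, hdef⟩ := exists_limit_of_eulerSchemes hΩ hU hUc hf hg
    (squeeze_zero (fun k => (hdpos k).le) hd hlim) hdpos hlim hXu t₀
  obtain ⟨c₀, hc₀⟩ : U.Nonempty := ⟨_, (hXu 0).input_mem 0⟩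
  have hderiv : ∀ t, t₀ ≤ t → DifferentiableAt ℝ x t → DifferentiableAt ℝ v t →
      deriv v t ∈ U ∧ deriv x t = f (x t) + g (x t) (deriv v t) := by
    intro t ht hxt hvt
    -- Right-hand slopes suffice, and the estimates on the limit are available only forward from
    -- `t`.
    have h1 := (hasDerivAt_iff_tendsto_slope.1 hxt.hasDerivAt).mono_left
      (nhdsWithin_mono t (show Ioi t ⊆ {t}ᶜ from fun r hr => ne_of_gt hr))
    have h2 := (hasDerivAt_iff_tendsto_slope.1 hvt.hasDerivAt).mono_left
      (nhdsWithin_mono t (show Ioi t ⊆ {t}ᶜ from fun r hr => ne_of_gt hr))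
    refine ⟨hU.isClosed.mem_of_tendsto h2 ?_, ?_⟩
    · filter_upwards [self_mem_nhdsWithin] with r hr
      exact hvU t r ht hr
    · rw [← sub_eq_zero, ← norm_le_zero_iff]
      refine le_of_forall_pos_le_add fun η hη => ?_
      rw [zero_add]
      obtain ⟨ρ, hρ, hle⟩ := hdef η hη
      have h3 := (h1.sub ((tendsto_const_nhds (x := f (x t))).add (((g (x t)).continuous.tendsto _).comp h2))).norm
      refine le_of_tendsto h3 ?_
      filter_upwards [Ioo_mem_nhdsGT (show t < t + ρ by linarith)] with r hr
      have hpos : 0 < r - t := sub_pos.2 hr.1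
      have h4 := hle t r ht hr.1.le (by linarith [hr.2])
      have h5 : slope x t r - (f (x t) + g (x t) (slope v t r))
          = (r - t)⁻¹ • (x r - x t - (r - t) • f (x t) - g (x t) (v r - v t)) := by
        simp only [slope, vsub_eq_sub, map_smul, smul_sub, smul_smul, inv_mul_cancel₀ hpos.ne',
          one_smul, map_sub]
        abel
      simp only [Function.comp_apply]
      rw [h5, norm_smul, Real.norm_of_nonneg (inv_pos.2 hpos).le, inv_mul_le_iff₀ hpos, mul_comm]
      exact h4
  -- The default `c₀` keeps the input admissible everywhere; from `t₀` on it is used only on a null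
  -- set.
  refine ⟨fun t => if deriv v t ∈ U then deriv v t else c₀, x,
    Measurable.ite (measurable_deriv v hU.measurableSet) (measurable_deriv v) measurable_const,
    fun t => ?_, hx0, solvesFrom_of_lipschitzWith hx ?_, hxΩ⟩
  · dsimp only
    split_ifs with h
    exacts [h, hc₀]
  · filter_upwards [hx.ae_differentiableAt_real, hv.ae_differentiableAt_real] with t h1 h2 ht
    obtain ⟨h3, h4⟩ := hderiv t ht h1 h2
    rw [if_pos h3, ← h4]
    exact h1.hasDerivAt

end Viability

/-! ### Nagumo's condition for sets with `C¹` boundary -/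

section Tangent

variable {n m : ℕ}

/-- Strict differentiability of the defining function controls its increments from every base point
near `x`, not only from `x`. Its first-order gain along `w` beats the error, so a nonnegative value
remains nonnegative. -/
theorem eventually_mem_of_inner_pos {Ω : Set (Vec n)} {x ν w : Vec n}
    (h : IsInwardUnitNormal Ω x ν) (hw : 0 < ⟪ν, w⟫) :
    ∀ᶠ p : Vec n × ℝ in 𝓝 (x, 0), p.1 ∈ Ω → 0 ≤ p.2 → p.1 + p.2 • w ∈ Ω := by
  obtain ⟨-, φ, hφ, -, hgrad, hΩ⟩ := h
  have hstrict := hφ.hasStrictFDerivAt one_ne_zero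
  rw [hgrad.hasFDerivAt.fderiv] at hstrict
  have hmap : Tendsto (fun p : Vec n × ℝ => (p.1 + p.2 • w, p.1)) (𝓝 (x, 0)) (𝓝 (x, x)) := by
    have hc : Continuous fun p : Vec n × ℝ => (p.1 + p.2 • w, p.1) := by fun_prop
    simpa using hc.tendsto (x, 0)
  -- Chosen so that the error over the displacement `p.2 • w` is at most the gain `p.2 * ⟪ν, w⟫`.
  have hc : 0 < ⟪ν, w⟫ / (‖w‖ + 1) := by positivity
  have h1 := hmap.eventually (hstrict.isLittleO.def hc)
  have h2 := ((continuous_fst.tendsto _).comp hmap).eventually hΩ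
  have h3 := ((continuous_snd.tendsto _).comp hmap).eventually hΩ
  filter_upwards [h1, h2, h3] with p hp1 hp2 hp3 hmem hnn
  refine hp2.2 ?_
  have h4 := hp3.1 hmem
  simp only [Function.comp_apply, add_sub_cancel_left, map_smul, norm_smul, smul_eq_mul,
    Real.norm_of_nonneg hnn, InnerProductSpace.toDual_apply_apply] at hp1 h4 ⊢
  have h5 : ⟪ν, w⟫ / (‖w‖ + 1) * (p.2 * ‖w‖) ≤ p.2 * ⟪ν, w⟫ := by
    rw [div_mul_eq_mul_div, div_le_iff₀ (by positivity)]
    nlinarith [mul_nonneg hnn hw.le]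
  have h6 := (abs_le.1 hp1).1
  linarith

end Tangent

variable {n m : ℕ} {S : ControlSystem n m}

theorem ControlSystem.isCompact_U : IsCompact S.U := by
  have h1 : S.U = (EuclideanSpace.equiv (Fin m) ℝ).toHomeomorph ⁻¹'
      (Set.Icc (fun j => S.uMin j) (fun j => S.uMax j)) := by
    ext u
    simp [ControlSystem.U, Set.mem_Icc, Pi.le_def, forall_and]
  rw [h1]
  exact (Homeomorph.isCompact_preimage _).2 isCompact_Icc

theorem ControlSystem.convex_U : Convex ℝ S.U := by
  have h1 : S.U = (EuclideanSpace.equiv (Fin m) ℝ).toLinearMap ⁻¹'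
      (Set.Icc (fun j => S.uMin j) (fun j => S.uMax j)) := by
    ext u
    simp [ControlSystem.U, Set.mem_Icc, Pi.le_def, forall_and]
  rw [h1]
  exact (convex_Icc _ _).linear_preimage _

theorem ControlSystem.uMin_mem_U : S.uMin ∈ S.U := fun j => ⟨le_rfl, S.uMin_le_uMax j⟩

/-- If an input points into `Ω`, then nearly the same direction can be followed for a short time
from every point of `Ω` nearby. -/
theorem exists_step_of_inner_nonneg {Ω : Set (Vec n)} (hΩX : Ω ⊆ S.X) {x : Vec n} (hxΩ : x ∈ Ω)
    {u : Vec m} (hu : x ∈ frontier Ω → ∃ ν, IsInwardUnitNormal Ω x ν ∧ 0 ≤ ⟪ν, S.F x u⟫)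
    {ε : ℝ} (hε : 0 < ε) :
    ∃ w, ∀ᶠ p : Vec n × ℝ in 𝓝 (x, 0), p.1 ∈ Ω → 0 ≤ p.2 →
      ‖w - S.F p.1 u‖ ≤ ε ∧ p.1 + p.2 • w ∈ Ω := by
  obtain ⟨w, hw, hmem⟩ : ∃ w, ‖w - S.F x u‖ ≤ ε / 2 ∧
      ∀ᶠ p : Vec n × ℝ in 𝓝 (x, 0), p.1 ∈ Ω → 0 ≤ p.2 → p.1 + p.2 • w ∈ Ω := by
    by_cases hfr : x ∈ frontier Ω
    · obtain ⟨ν, hν, hnn⟩ := hu hfr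
      -- The tilt along the unit normal turns the nonstrict inward condition into a strict one at
      -- cost `ε / 2`.
      refine ⟨S.F x u + (ε / 2) • ν, ?_, eventually_mem_of_inner_pos hν ?_⟩
      · rw [add_sub_cancel_left, norm_smul, hν.1, mul_one, Real.norm_of_nonneg (by positivity)]
      · rw [inner_add_right, inner_smul_right, real_inner_self_eq_norm_sq, hν.1]
        linarith
    · refine ⟨S.F x u, by simpa using (by positivity), ?_⟩
      have hint : x ∈ interior Ω := by
        by_contra h
        exact hfr ⟨subset_closure hxΩ, h⟩
      have hc : Continuous fun p : Vec n × ℝ => p.1 + p.2 • S.F x u := by fun_prop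
      have ht : Tendsto (fun p : Vec n × ℝ => p.1 + p.2 • S.F x u) (𝓝 (x, 0)) (𝓝 x) := by
        simpa using hc.tendsto (x, 0)
      filter_upwards [ht.eventually (mem_interior_iff_mem_nhds.1 hint)] with p hp _ _ using hp
  refine ⟨w, ?_⟩
  have hcont : ContinuousWithinAt (fun y => S.F y u) Ω x :=
    (((S.continuousOn_f.mono hΩX) x hxΩ).add
      (((S.continuousOn_g.mono hΩX) x hxΩ).clm_apply continuousWithinAt_const))
  have hev : ∀ᶠ y in 𝓝 x, y ∈ Ω → ‖S.F y u - S.F x u‖ < ε / 2 := by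
    have := hcont.tendsto.eventually (Metric.ball_mem_nhds _ (half_pos hε))
    rw [eventually_nhdsWithin_iff] at this
    filter_upwards [this] with y hy hyΩ
    simpa [dist_eq_norm] using hy hyΩ
  filter_upwards [hmem, (continuous_fst.tendsto (x, (0 : ℝ))).eventually hev] with p h1 h2 hp hnn
  refine ⟨?_, h1 hp hnn⟩
  calc ‖w - S.F p.1 u‖ = ‖(w - S.F x u) - (S.F p.1 u - S.F x u)‖ := by congr 1; abel
    _ ≤ ‖w - S.F x u‖ + ‖S.F p.1 u - S.F x u‖ := norm_sub_le _ _
    _ ≤ ε := by linarith [h2 hp]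

/-- Near each point a single input and direction serve all points of `Ω`; finitely many such
neighbourhoods cover `Ω`, and the smallest of their step bounds is positive. -/
theorem exists_uniform_step {Ω : Set (Vec n)} (hΩ : IsCompact Ω) (hΩX : Ω ⊆ S.X)
    (hfr : ∀ x ∈ frontier Ω, ∃ u ∈ S.U, ∃ ν, IsInwardUnitNormal Ω x ν ∧ 0 ≤ ⟪ν, S.F x u⟫)
    {ε : ℝ} (hε : 0 < ε) :
    ∃ δ₀ > (0 : ℝ), ∀ δ : ℝ, 0 < δ → δ ≤ δ₀ → ∀ y ∈ Ω,
      ∃ u ∈ S.U, ∃ w, ‖w - (S.f y + S.g y u)‖ ≤ ε ∧ y + δ • w ∈ Ω := by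
  suffices h : ∃ δ₀ > (0 : ℝ), ∀ δ : ℝ, 0 < δ → δ ≤ δ₀ → ∀ y ∈ Ω, y ∈ Ω →
      ∃ u ∈ S.U, ∃ w, ‖w - (S.f y + S.g y u)‖ ≤ ε ∧ y + δ • w ∈ Ω by
    obtain ⟨δ₀, hδ₀, h⟩ := h
    exact ⟨δ₀, hδ₀, fun δ h0 h1 y hy => h δ h0 h1 y hy hy⟩
  refine hΩ.induction_on (p := fun A => ∃ δ₀ > (0 : ℝ), ∀ δ : ℝ, 0 < δ → δ ≤ δ₀ →
    ∀ y ∈ A, y ∈ Ω → ∃ u ∈ S.U, ∃ w, ‖w - (S.f y + S.g y u)‖ ≤ ε ∧ y + δ • w ∈ Ω)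
    ⟨1, one_pos, by simp⟩ ?_ ?_ ?_
  · rintro A B hAB ⟨δ₀, hδ₀, h⟩
    exact ⟨δ₀, hδ₀, fun δ h0 h1 y hy => h δ h0 h1 y (hAB hy)⟩
  · rintro A B ⟨δA, hδA, hA⟩ ⟨δB, hδB, hB⟩
    refine ⟨min δA δB, lt_min hδA hδB, fun δ h0 h1 y hy => ?_⟩
    rcases hy with hy | hy
    · exact hA δ h0 (h1.trans (min_le_left _ _)) y hy
    · exact hB δ h0 (h1.trans (min_le_right _ _)) y hy
  · intro x hx
    obtain ⟨u, huU, hu⟩ : ∃ u ∈ S.U,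
        (x ∈ frontier Ω → ∃ ν, IsInwardUnitNormal Ω x ν ∧ 0 ≤ ⟪ν, S.F x u⟫) := by
      by_cases h : x ∈ frontier Ω
      · obtain ⟨u, hu, hν⟩ := hfr x h
        exact ⟨u, hu, fun _ => hν⟩
      · exact ⟨S.uMin, S.uMin_mem_U, fun h' => absurd h' h⟩
    obtain ⟨w, hw⟩ := exists_step_of_inner_nonneg hΩX hx hu hε
    rw [nhds_prod_eq, eventually_prod_iff] at hw
    obtain ⟨pa, ha, pb, hb, hab⟩ := hw
    obtain ⟨r, hr, hball⟩ := Metric.eventually_nhds_iff.1 hb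
    refine ⟨{y | pa y}, mem_nhdsWithin_of_mem_nhds ha, r / 2, half_pos hr,
      fun δ h0 h1 y hy hyΩ => ⟨u, huU, w, ?_⟩⟩
    refine hab hy (hball ?_) hyΩ h0.le
    rw [Real.dist_eq, sub_zero, abs_of_pos h0]
    linarith

/-- Nagumo's condition for control invariance of a compact set with `C¹` boundary. -/
theorem ControlSystem.isControlInvariant_of_inner_nonneg {Ω : Set (Vec n)} (hΩ : IsCompact Ω)
    (hΩX : Ω ⊆ S.X)
    (hfr : ∀ x ∈ frontier Ω, ∃ u ∈ S.U, ∃ ν, IsInwardUnitNormal Ω x ν ∧ 0 ≤ ⟪ν, S.F x u⟫) :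
    S.IsControlInvariant Ω := by
  intro t₀ x₀ hx₀
  obtain ⟨u, x, hmeas, huU, hx0, hsol, hxΩ⟩ := exists_viable_trajectory hΩ S.isCompact_U
    S.convex_U (S.continuousOn_f.mono hΩX) (S.continuousOn_g.mono hΩX) hx₀
    (fun ε hε => exists_uniform_step hΩ hΩX hfr hε) t₀
  exact ⟨u, x, hmeas, fun t _ => huU t, hx0, hsol, fun t _ => hxΩ t⟩

/-! ### Tightened margins as a certificate -/

variable {N : ℕ} {M : SetModel n N}

theorem ControlSystem.norm_le_lipLP {u : Vec m} (hu : u ∈ S.U) : ‖u‖ ≤ S.lipLP := by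
  unfold ControlSystem.lipLP
  rw [EuclideanSpace.norm_eq, EuclideanSpace.norm_eq]
  refine Real.sqrt_le_sqrt (Finset.sum_le_sum fun j _ => ?_)
  have h : ‖u j‖ ≤ max |S.uMin j| |S.uMax j| := abs_le_max_abs_abs (hu j).1 (hu j).2
  exact pow_le_pow_left₀ (norm_nonneg _) (h.trans (le_abs_self _)) 2

theorem ControlSystem.inner_eq_bStar {ν x : Vec n} {u : Vec m} (hu : u ∈ S.optimalInputs ν x) :
    ⟪ν, S.F x u⟫ = S.bStar ν x := by
  have hg : IsGreatest ((fun u => ⟪ν, S.F x u⟫) '' S.U) ⟪ν, S.F x u⟫ :=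
    ⟨mem_image_of_mem _ hu.1, by rintro _ ⟨v, hv, rfl⟩; exact hu.2 hv⟩
  exact hg.csSup_eq.symm

theorem ControlSystem.inner_le_bStar {ν x : Vec n} {u : Vec m} (hu : u ∈ S.U) :
    ⟪ν, S.F x u⟫ ≤ S.bStar ν x := by
  refine le_csSup (S.isCompact_U.image ?_).bddAbove (mem_image_of_mem _ hu)
  unfold ControlSystem.F
  fun_prop

theorem SetModel.marginAt_le_bTilde {u : Vec m} (hu : u ∈ S.U) (i : Fin N) (s : SetState n N) :
    M.marginAt S u i s ≤ M.bTilde S s i :=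
  sub_le_sub_right (S.inner_le_bStar hu) _

theorem SetModel.marginAt_eq_bTilde {u : Vec m} {i : Fin N} {s : SetState n N}
    (hu : u ∈ S.optimalInputs (M.normal s (s i)) (s i)) :
    M.marginAt S u i s = M.bTilde S s i := by
  rw [SetModel.marginAt, SetModel.bTilde, S.inner_eq_bStar hu]

/-- The margin of a fixed input along the boundary decreases at most at the rate `L`. -/
theorem SetModel.IsValid.inner_sub_le (hM : M.IsValid S) {s : SetState n N}
    (hs : s ∈ M.admissible) {x y : Vec n} (hx : x ∈ frontier (M.Ω s)) (hy : y ∈ frontier (M.Ω s))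
    {u : Vec m} (hu : u ∈ S.U) :
    ⟪M.normal s y, S.F y u⟫ - M.lip S s * dist x y ≤ ⟪M.normal s x, S.F x u⟫ := by
  have h1 := (hM.lipschitz_nf s hs).dist_le_mul y hy x hx
  have h2 := (hM.lipschitz_ng s hs).dist_le_mul y hy x hx
  rw [Real.dist_eq, dist_comm] at h1
  rw [dist_eq_norm, dist_comm] at h2
  have h3 := (real_inner_le_norm ((S.g y).adjoint (M.normal s y) - (S.g x).adjoint (M.normal s x))
    u).trans (mul_le_mul h2 (S.norm_le_lipLP hu) (norm_nonneg _) (by positivity))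
  rw [inner_sub_left, ContinuousLinearMap.adjoint_inner_left,
    ContinuousLinearMap.adjoint_inner_left] at h3
  have h4 := (abs_le.1 h1).2
  simp only [ControlSystem.F, inner_add_right, SetModel.lip]
  linarith

/-- Nonnegative tightened margins certify control invariance. -/
theorem SetModel.IsValid.isControlInvariant (hM : M.IsValid S) {s : SetState n N}
    (hs : s ∈ M.admissible) {u : Fin N → Vec m}
    (hu : ∀ i, u i ∈ S.optimalInputs (M.normal s (s i)) (s i)) (hb : ∀ i, 0 ≤ M.bTilde S s i) :
    S.IsControlInvariant (M.Ω s) := by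
  refine S.isControlInvariant_of_inner_nonneg (hM.isCompact_Ω s hs) (hM.Ω_subset s hs)
    fun x hx => ?_
  obtain ⟨i, hi⟩ := mem_iUnion.1 (hM.cover s hs hx)
  -- The input that is optimal at the covering control point also serves at `x`.
  refine ⟨u i, (hu i).1, _, hM.normal_spec s hs x hx, ?_⟩
  have h1 := hM.inner_sub_le hs hx (hM.point_mem s hs i) (hu i).1
  have h2 := hb i
  rw [← SetModel.marginAt_eq_bTilde (hu i), SetModel.marginAt] at h2
  have h3 : 0 ≤ M.lip S s := by
    have : 0 ≤ S.lipLP := norm_nonneg _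
    unfold SetModel.lip
    positivity
  have h4 := mul_le_mul_of_nonneg_left (Metric.mem_closedBall.1 hi) h3
  linarith

/-! ### Absolutely continuous functions and Carathéodory curves -/

theorem absolutelyContinuousOnInterval_of_dist_le {F G : Type*} [PseudoMetricSpace F]
    [PseudoMetricSpace G] {φ : ℝ → F} {ψ : ℝ → G} {a b C : ℝ}
    (hψ : AbsolutelyContinuousOnInterval ψ a b)
    (h : ∀ x ∈ uIcc a b, ∀ y ∈ uIcc a b, dist (φ x) (φ y) ≤ C * dist (ψ x) (ψ y)) :
    AbsolutelyContinuousOnInterval φ a b := by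
  have h0 := Tendsto.const_mul C hψ
  rw [mul_zero] at h0
  refine squeeze_zero' (Eventually.of_forall fun I => Finset.sum_nonneg fun _ _ => dist_nonneg)
    ?_ h0
  have hmem : ∀ᶠ I in AbsolutelyContinuousOnInterval.totalLengthFilter ⊓
      𝓟 (AbsolutelyContinuousOnInterval.disjWithin a b),
      I ∈ AbsolutelyContinuousOnInterval.disjWithin a b := eventually_inf_principal.2 (by simp)
  filter_upwards [hmem] with I hI
  rw [Finset.mul_sum]
  exact Finset.sum_le_sum fun j hj => h _ (hI.1 j hj).1 _ (hI.1 j hj).2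

/-- If `β b < 0`, let `c` be the last time at which `β` is nonnegative. On `(c, b]` it is negative,
so integrating its derivative gives `β b ≥ β c ≥ 0`. -/
theorem nonneg_of_absolutelyContinuousOnInterval {β : ℝ → ℝ} {a b : ℝ} (hab : a ≤ b)
    (hβ : AbsolutelyContinuousOnInterval β a b) (ha : 0 ≤ β a)
    (hderiv : ∀ᵐ t, t ∈ Ioo a b → β t < 0 → 0 ≤ deriv β t) : 0 ≤ β b := by
  by_contra! hb
  have hcont : ContinuousOn β (Icc a b) := uIcc_of_le hab ▸ hβ.continuousOn
  have hcpt : IsCompact (Icc a b ∩ β ⁻¹' Ici 0) :=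
    isCompact_Icc.of_isClosed_subset (hcont.preimage_isClosed_of_isClosed isClosed_Icc isClosed_Ici)
      inter_subset_left
  obtain ⟨c, ⟨hc, hc0⟩, hmax⟩ := hcpt.exists_isGreatest ⟨a, left_mem_Icc.2 hab, ha⟩
  have hac : AbsolutelyContinuousOnInterval β c b := hβ.mono (by
    rw [uIcc_of_le hab, uIcc_of_le hc.2]
    exact Icc_subset_Icc_left hc.1)
  have hint := hac.integral_deriv_eq_sub
  have hnn : 0 ≤ ∫ t in c..b, deriv β t := by
    refine intervalIntegral.integral_nonneg_of_ae_restrict hc.2 ?_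
    have hb' : ∀ᵐ t : ℝ, t ≠ b := by simp [ae_iff, measure_singleton]
    have hc' : ∀ᵐ t : ℝ, t ≠ c := by simp [ae_iff, measure_singleton]
    refine (ae_restrict_iff' measurableSet_Icc).2 ?_
    filter_upwards [hderiv, hb', hc'] with t ht htb htc hmem
    have h1 : c < t := lt_of_le_of_ne hmem.1 htc.symm
    refine ht ⟨hc.1.trans_lt h1, lt_of_le_of_ne hmem.2 htb⟩ ?_
    by_contra! h2
    exact absurd (hmax ⟨⟨hc.1.trans h1.le, hmem.2⟩, h2⟩) (not_le.2 h1)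
  have : 0 ≤ β c := hc0
  linarith

namespace SolvesFrom

variable {F : Type*} [NormedAddCommGroup F] [NormedSpace ℝ F]
  {t₀ T : ℝ} {x v : ℝ → F}

theorem dist_le (h : SolvesFrom t₀ x v) {a b : ℝ} (ha : t₀ ≤ a) (hb : t₀ ≤ b) :
    dist (x a) (x b) ≤ dist (∫ τ in t₀..a, ‖v τ‖) (∫ τ in t₀..b, ‖v τ‖) := by
  obtain ⟨ia, ea⟩ := h a ha
  obtain ⟨ib, eb⟩ := h b hb
  rw [ea, eb, dist_add_left, dist_eq_norm, Real.dist_eq,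
    intervalIntegral.integral_interval_sub_left ia ib,
    intervalIntegral.integral_interval_sub_left ia.norm ib.norm]
  exact intervalIntegral.norm_integral_le_abs_integral_norm

theorem absolutelyContinuousOnInterval (h : SolvesFrom t₀ x v) (hT : t₀ ≤ T) :
    AbsolutelyContinuousOnInterval x t₀ T := by
  refine absolutelyContinuousOnInterval_of_dist_le (C := 1)
    ((h T hT).1.norm.absolutelyContinuousOnInterval_intervalIntegral left_mem_uIcc)
    fun a ha b hb => ?_
  rw [uIcc_of_le hT] at ha hb
  rw [one_mul]
  exact h.dist_le ha.1 hb.1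

theorem ae_hasDerivAt [CompleteSpace F] (h : SolvesFrom t₀ x v) (hT : t₀ ≤ T) :
    ∀ᵐ t, t ∈ Ioo t₀ T → HasDerivAt x (v t) t := by
  filter_upwards [(h T hT).1.ae_hasDerivAt_integral] with t ht hmem
  rw [uIcc_of_le hT] at ht
  refine ((ht ⟨hmem.1.le, hmem.2.le⟩ t₀ (left_mem_Icc.2 hT)).const_add (x t₀)).congr_of_eventuallyEq
    ?_
  filter_upwards [lt_mem_nhds hmem.1] with r hr using (h r hr.le).2

end SolvesFrom

theorem locallyLipschitzOn_of_contDiffOn {F G : Type*} [NormedAddCommGroup F] [NormedSpace ℝ F]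
    [NormedAddCommGroup G] [NormedSpace ℝ G] {φ : F → G} {D : Set F} (hD : IsOpen D)
    (h : ContDiffOn ℝ 1 φ D) : LocallyLipschitzOn D φ := fun x hx => by
  obtain ⟨K, t, ht, hK⟩ := (h.contDiffAt (hD.mem_nhds hx)).exists_lipschitzOnWith
  exact ⟨K, t, mem_nhdsWithin_of_mem_nhds ht, hK⟩

/-! ### Tightened margins along the set dynamics -/

namespace SetModel

variable {n m N : ℕ} {S : ControlSystem n m} {M : SetModel n N}

/-- The margin is affine in the input; this reduces a bound uniform over the box to the `m + 1`
inputs `uMin` and `uMin + w j`. -/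
theorem marginAt_add_sum (i : Fin N) (s : SetState n N) {ι : Type*} (A : Finset ι) (a : Vec m)
    (c : ι → ℝ) (w : ι → Vec m) :
    M.marginAt S (a + ∑ j ∈ A, c j • w j) i s =
      M.marginAt S a i s + ∑ j ∈ A, c j * (M.marginAt S (a + w j) i s - M.marginAt S a i s) := by
  simp only [marginAt, ControlSystem.F, map_add, map_sum, map_smul, inner_add_right, inner_sum,
    inner_smul_right]
  have h : ∀ j, ⟪M.normal s (s i), S.f (s i)⟫ +
      (⟪M.normal s (s i), S.g (s i) a⟫ + ⟪M.normal s (s i), S.g (s i) (w j)⟫)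
      - M.lip S s * M.radius s i - (⟪M.normal s (s i), S.f (s i)⟫ +
      ⟪M.normal s (s i), S.g (s i) a⟫ - M.lip S s * M.radius s i)
      = ⟪M.normal s (s i), S.g (s i) (w j)⟫ := fun j => by ring
  simp only [h]
  ring

/-- Over a compact set of admissible set states, the margins of all fixed inputs share a Lipschitz
constant. -/
theorem IsValid.exists_dist_marginAt_le (hM : M.IsValid S) {A : Set (SetState n N)}
    (hA : IsCompact A) (hAD : A ⊆ M.admissible) (i : Fin N) :
    ∃ C ≥ (0 : ℝ), ∀ u ∈ S.U, ∀ s ∈ A, ∀ s' ∈ A,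
      |M.marginAt S u i s - M.marginAt S u i s'| ≤ C * dist s s' := by
  let w : Fin m → Vec m := fun j => EuclideanSpace.single j (S.uMax j - S.uMin j)
  have hlip : ∀ u ∈ S.U, ∃ K : ℝ≥0, LipschitzOnWith K (M.marginAt S u i) A := fun u hu =>
    ((locallyLipschitzOn_of_contDiffOn hM.isOpen_admissible
      (hM.contDiffOn_margin u hu i)).mono hAD).exists_lipschitzOnWith_of_compact hA
  have hw : ∀ j, S.uMin + w j ∈ S.U := by
    intro j k
    have := S.uMin_le_uMax k
    rcases eq_or_ne k j with rfl | hkj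
    · simpa [w] using this
    · simpa [w, hkj] using this
  obtain ⟨K₀, hK₀⟩ := hlip _ S.uMin_mem_U
  choose K hK using fun j => hlip _ (hw j)
  refine ⟨K₀ + ∑ j, ((K j : ℝ) + K₀), by positivity, fun u hu s hs s' hs' => ?_⟩
  let c : Fin m → ℝ := fun j => (u j - S.uMin j) / (S.uMax j - S.uMin j)
  have hc0 : ∀ j, 0 ≤ c j := fun j =>
    div_nonneg (sub_nonneg.2 (hu j).1) (sub_nonneg.2 (S.uMin_le_uMax j))
  have hc1 : ∀ j, c j ≤ 1 := fun j =>
    div_le_one_of_le₀ (sub_le_sub_right (hu j).2 _) (sub_nonneg.2 (S.uMin_le_uMax j))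
  have hudec : u = S.uMin + ∑ j, c j • w j := by
    ext k
    -- On a degenerate side of the box the denominator vanishes, but then `u k = uMin k`.
    have hk : c k * (S.uMax k - S.uMin k) = u k - S.uMin k := by
      refine div_mul_cancel_of_imp fun h => ?_
      linarith [(hu k).1, (hu k).2]
    simp [w, Pi.single_apply, hk]
  have h0 := hK₀.dist_le_mul s hs s' hs'
  rw [Real.dist_eq] at h0
  have hj : ∀ j, |c j * (M.marginAt S (S.uMin + w j) i s - M.marginAt S S.uMin i s)
      - c j * (M.marginAt S (S.uMin + w j) i s' - M.marginAt S S.uMin i s')|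
      ≤ (K j + K₀) * dist s s' := by
    intro j
    have h1 := (hK j).dist_le_mul s hs s' hs'
    rw [Real.dist_eq] at h1
    rw [← mul_sub, abs_mul, abs_of_nonneg (hc0 j)]
    refine (mul_le_of_le_one_left (abs_nonneg _) (hc1 j)).trans ?_
    rw [sub_sub_sub_comm]
    refine (abs_sub _ _).trans ?_
    linarith
  rw [hudec, marginAt_add_sum, marginAt_add_sum, add_sub_add_comm, ← Finset.sum_sub_distrib,
    add_mul, Finset.sum_mul]
  exact (abs_add_le _ _).trans (add_le_add h0
    ((Finset.abs_sum_le_sum_abs _ _).trans (Finset.sum_le_sum fun j _ => hj j)))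

/-- A maximum of functions with a common Lipschitz constant keeps it: the input optimal at one state
is a competitor at the other. -/
theorem IsValid.exists_dist_bTilde_le (hM : M.IsValid S) {uStar : SetState n N → Fin N → Vec m}
    (huStar : ∀ σ ∈ M.admissible, ∀ i, uStar σ i ∈ S.optimalInputs (M.normal σ (σ i)) (σ i))
    {A : Set (SetState n N)} (hA : IsCompact A) (hAD : A ⊆ M.admissible) (i : Fin N) :
    ∃ C ≥ (0 : ℝ), ∀ s ∈ A, ∀ s' ∈ A, |M.bTilde S s i - M.bTilde S s' i| ≤ C * dist s s' := by
  obtain ⟨C, hC0, hC⟩ := hM.exists_dist_marginAt_le hA hAD i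
  have hle : ∀ s ∈ A, ∀ s' ∈ A, M.bTilde S s i - M.bTilde S s' i ≤ C * dist s s' := by
    intro s hs s' hs'
    have hu := huStar s (hAD hs) i
    rw [← marginAt_eq_bTilde hu]
    linarith [(abs_le.1 (hC _ hu.1 s hs s' hs')).2, M.marginAt_le_bTilde hu.1 i s']
  refine ⟨C, hC0, fun s hs s' hs' => abs_sub_le_iff.2 ⟨hle s hs s' hs', ?_⟩⟩
  rw [dist_comm]
  exact hle s' hs' s hs

/-- Along a differentiable curve the tightened margin, where differentiable, has the derivative
given by the gradient with the optimal input held fixed. -/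
theorem IsValid.deriv_bTilde_comp (hM : M.IsValid S) {uStar : SetState n N → Fin N → Vec m}
    {s : ℝ → SetState n N} {t : ℝ} {η : SetState n N} {i : Fin N} (hadm : s t ∈ M.admissible)
    (hu : uStar (s t) i ∈ S.optimalInputs (M.normal (s t) (s t i)) (s t i))
    (hs : HasDerivAt s η t) (hb : DifferentiableAt ℝ (fun r => M.bTilde S (s r) i) t) :
    deriv (fun r => M.bTilde S (s r) i) t = M.gradBTilde S uStar (s t) i η := by
  have hm : DifferentiableAt ℝ (M.marginAt S (uStar (s t) i) i) (s t) :=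
    ((hM.contDiffOn_margin _ hu.1 i).contDiffAt
      (hM.isOpen_admissible.mem_nhds hadm)).differentiableAt one_ne_zero
  have hφ := hm.hasFDerivAt.comp_hasDerivAt t hs
  -- The gap between the optimized and the fixed-input margin is nonnegative and vanishes at time
  -- `t`, so its derivative there is zero.
  have hmin : IsLocalMin
      ((fun r => M.bTilde S (s r) i) - (M.marginAt S (uStar (s t) i) i) ∘ s) t := by
    refine Eventually.of_forall fun r => ?_
    simp only [Pi.sub_apply, Function.comp_apply, marginAt_eq_bTilde hu, sub_self]
    exact sub_nonneg.2 (M.marginAt_le_bTilde hu.1 i (s r))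
  exact sub_eq_zero.1 (hmin.hasDerivAt_eq_zero (hb.hasDerivAt.sub hφ))

/-- The barrier constraints of the quadratic program keep the tightened margins nonnegative. -/
theorem IsValid.bTilde_nonneg (hM : M.IsValid S) {uStar : SetState n N → Fin N → Vec m}
    (huStar : ∀ σ ∈ M.admissible, ∀ i, uStar σ i ∈ S.optimalInputs (M.normal σ (σ i)) (σ i))
    {α : ℝ → ℝ} (hα : StrictMono α) (hα0 : α 0 = 0) {t₀ : ℝ} {s η : ℝ → SetState n N}
    (hs : SolvesFrom t₀ s η) (hadm : ∀ t, t₀ ≤ t → s t ∈ M.admissible)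
    (hη : ∀ t, t₀ ≤ t → η t ∈ M.qpFeasible S uStar α (s t)) {i : Fin N}
    (hinit : 0 ≤ M.bTilde S (s t₀) i) {t : ℝ} (ht : t₀ ≤ t) : 0 ≤ M.bTilde S (s t) i := by
  have hac := hs.absolutelyContinuousOnInterval ht
  have hcont : ContinuousOn s (Icc t₀ t) := uIcc_of_le ht ▸ hac.continuousOn
  obtain ⟨C, -, hC⟩ := hM.exists_dist_bTilde_le huStar (isCompact_Icc.image_of_continuousOn hcont)
    (by rintro _ ⟨r, hr, rfl⟩; exact hadm r hr.1) i
  refine nonneg_of_absolutelyContinuousOnInterval (β := fun r => M.bTilde S (s r) i) ht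
    (absolutelyContinuousOnInterval_of_dist_le (C := C) hac fun a ha b hb => ?_) hinit ?_
  · rw [uIcc_of_le ht] at ha hb
    exact hC _ (mem_image_of_mem s ha) _ (mem_image_of_mem s hb)
  · filter_upwards [hs.ae_hasDerivAt ht] with r hr hmem hneg
    by_cases hd : DifferentiableAt ℝ (fun r => M.bTilde S (s r) i) r
    · have hadm' := hadm r hmem.1.le
      rw [hM.deriv_bTilde_comp hadm' (huStar _ hadm' i) (hr hmem) hd]
      have h1 := hη r hmem.1.le i
      have h2 := hα hneg
      rw [hα0] at h2
      linarith
    -- The default value `0` of `deriv` meets the required bound.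
    · rw [deriv_zero_of_not_differentiableAt hd]

end SetModel

end SetExpansion

theorem mainTheorem2 {n m N : ℕ}
    (S : SetExpansion.ControlSystem n m) (M : SetExpansion.SetModel n N) (hM : M.IsValid S)
    (α : ℝ → ℝ) (hα : Continuous α) (hαmono : StrictMono α) (hα0 : α 0 = 0)
    (Q : Matrix (Fin N × Fin n) (Fin N × Fin n) ℝ)
    (ηref : SetExpansion.SetState n N → SetExpansion.SetState n N)
    (uStar : SetExpansion.SetState n N → Fin N → SetExpansion.Vec m)
    (huStar : ∀ σ ∈ M.admissible, ∀ i, uStar σ i ∈ S.optimalInputs (M.normal σ (σ i)) (σ i))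
    (ηs : SetExpansion.SetState n N → SetExpansion.SetState n N)
    (hηs : ∀ σ ∈ M.admissible, (M.qpFeasible S uStar α σ).Nonempty →
      ηs σ ∈ M.qpSolutions S uStar α Q ηref σ)
    (t₀ : ℝ) (s : ℝ → SetExpansion.SetState n N)
    (hs : SetExpansion.SolvesFrom t₀ s (fun t => ηs (s t)))
    (hadm : ∀ t, t₀ ≤ t → s t ∈ M.admissible)
    (hinit : ∀ i, 0 ≤ M.bTilde S (s t₀) i)
    (hfeas : ∀ t, t₀ ≤ t → (M.qpFeasible S uStar α (s t)).Nonempty) :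
    ∀ t, t₀ ≤ t → S.IsControlInvariant (M.Ω (s t)) := by
  have hηfeas : ∀ t, t₀ ≤ t → ηs (s t) ∈ M.qpFeasible S uStar α (s t) := fun t ht =>
    (hηs _ (hadm t ht) (hfeas t ht)).1
  exact fun t ht => hM.isControlInvariant (hadm t ht) (huStar _ (hadm t ht)) fun i =>
    hM.bTilde_nonneg huStar hαmono hα0 hs hadm hηfeas (hinit i) ht
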